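/- **Theorem (Generalization bound for GTPs — Version 1).** There is a universal constant $C>0$ such that the following holds. Let $d,m\in\mathbb{N}$ with $d,m\ge 1$. Let $\Omega\subset\mathbb{R}^d$ be a finite set of frequency vectors with $0\in\Omega$ and $\Omega=-\Omega$, $\Omega\neq\{0\}$, and let $\Omega\setminus\{0\}=\Omega_+\cup\Omega_-$ be a partition into disjoint sets such that $\omega\in\Omega_+$ if and only if $-\omega\in\Omega_-$ (so $|\Omega|=2|\Omega_+|+1$). Put $K:=\sum_{i=1}^d\max_{\omega\in\Omega_+}|\omega_i|$. For $\tilde B>0$, let $\mathcal{H}_\Omega^{\tilde B}$ be the class of generalized trigonometric polynomials $$[0,2\pi)^d\ni x\mapsto \frac{a_0}{2}+\sum_{\omega\in\Omega_+}\big(a_\omega\cos(\omega\cdot x)+b_\omega\sin(\omega\cdot x)\big)$$ with real coefficients satisfying $\sqrt{a_0^2+\sum_{\omega\in\Omega_+}(a_\omega^2+b_\omega^2)}\le\tilde B$. Let $\ell:\mathbb{R}\times\mathbb{R}\to[0,c]$ be a measurable loss function such that $z\mapsto\ell(y,z)$ is $L$-Lipschitz for every $y\in\mathbb{R}$. For a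 probability measure $P$ on $[0,2\pi)^d\times\mathbb{R}$, $f:[0,2\pi)^d\to\mathbb{R}$ and $S=\{(x_i,y_i)\}_{i=1}^m$, write $R(f)=\int\ell(y,f(x))\,\mathrm{d}P(x,y)$ and $\hat R_S(f)=\frac1m\sum_{i=1}^m\ell(y_i,f(x_i))$. Then for every $\delta\in(0,1)$ and every probability measure $P$ on $[0,2\pi)^d\times\mathbb{R}$, with probability at least $1-\delta$ over the choice of $m$ i.i.d. samples $S$ from $P$, the following holds simultaneously for all $f\in\mathcal{H}_\Omega^{\tilde B}$: $$R(f)-\hat R_S(f)\le C\left(\frac{L\,\min\left\{\max\{K,\tilde B\sqrt{|\Omega|}\}\sqrt{\log(2d)},\ \tilde B\sqrt{|\Omega|\log|\Omega|}\right\}}{\sqrt m}+\frac{c\,\sqrt{\log(1/\delta)}}{\sqrt m}\right).$$ -/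

import Mathlib

noncomputable section

namespace GTP

/-- The input domain `[0, 2π)^d`. -/
abbrev Input (d : ℕ) : Type := Fin d → Set.Ico (0 : ℝ) (2 * Real.pi)

/-- The product `ω x = ∑ i, ω_i x_i` of a frequency vector with an input. -/
def phase {d : ℕ} (ω : Fin d → ℝ) (x : Input d) : ℝ := ∑ i, ω i * (x i : ℝ)

/-- `Ω` is a finite set of frequency vectors containing `0`, and its nonzero part is split into
two disjoint parts `Ωpos` and `Ωneg` that are exchanged by `ω ↦ -ω`. -/
structure IsSplit {d : ℕ} (Ω Ωpos Ωneg : Finset (Fin d → ℝ)) : Prop where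
  zero_mem : 0 ∈ Ω
  union_eq : Ωpos ∪ Ωneg = Ω.erase 0
  disjoint : Disjoint Ωpos Ωneg
  neg_mem_iff : ∀ ω, ω ∈ Ωpos ↔ -ω ∈ Ωneg

/-- The real generalized trigonometric polynomial
`x ↦ a₀ / 2 + ∑_{ω ∈ Ωpos} (a_ω cos (ω x) + b_ω sin (ω x))`. -/
def gtp {d : ℕ} (Ωpos : Finset (Fin d → ℝ)) (a₀ : ℝ) (a b : Ωpos → ℝ) (x : Input d) : ℝ :=
  a₀ / 2 + ∑ ω : Ωpos, (a ω * Real.cos (phase ω.1 x) + b ω * Real.sin (phase ω.1 x))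

/-- The `2`-norm of the coefficient vector `(a₀, (a_ω)_ω, (b_ω)_ω)`. -/
def coeffNorm {d : ℕ} {Ωpos : Finset (Fin d → ℝ)} (a₀ : ℝ) (a b : Ωpos → ℝ) : ℝ :=
  √(a₀ ^ 2 + ∑ ω : Ωpos, (a ω ^ 2 + b ω ^ 2))

/-- The class of generalized trigonometric polynomials with coefficient `2`-norm at most `B`. -/
def gtpClass {d : ℕ} (Ωpos : Finset (Fin d → ℝ)) (B : ℝ) : Set (Input d → ℝ) :=
  {f | ∃ (a₀ : ℝ) (a b : Ωpos → ℝ), coeffNorm a₀ a b ≤ B ∧ f = gtp Ωpos a₀ a b}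

/-- `K = ∑ i, K_i` with `K_i = max_{ω ∈ Ωpos} |ω_i|`. -/
def freqBound {d : ℕ} (Ωpos : Finset (Fin d → ℝ)) (h : Ωpos.Nonempty) : ℝ :=
  ∑ i, Ωpos.sup' h fun ω => |ω i|

/-- The risk `R(f) = ∫ ℓ(y, f(x)) dP(x, y)`. -/
def risk {d : ℕ} (ℓ : ℝ → ℝ → ℝ) (P : MeasureTheory.Measure (Input d × ℝ))
    (f : Input d → ℝ) : ℝ :=
  ∫ p, ℓ p.2 (f p.1) ∂P

/-- The empirical risk `(1 / m) ∑ i, ℓ(y_i, f(x_i))` on the sample `S = ((x_i, y_i))_i`. -/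
def empRisk {d m : ℕ} (ℓ : ℝ → ℝ → ℝ) (S : Fin m → Input d × ℝ) (f : Input d → ℝ) : ℝ :=
  (1 / (m : ℝ)) * ∑ i, ℓ (S i).2 (f (S i).1)

end GTP

end

/-! A generalized trigonometric polynomial is the inner product of its coefficient vector with the
feature vector `(1/2, cos, sin)`, whose squared norm `1/4 + |Ω₊|` is at most `|Ω|`. The class is
thus a ball of linear predictors. Contraction (`sum_sign_iSup_contraction`) removes the loss at the
cost of a factor `L`, and orthogonality of signs (`sum_sign_iSup_inner_le`) bounds the Rademacher
sum by `L B √(m|Ω|)`. Symmetrization and McDiarmid's inequality turn this into a uniform deviation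
bound.

The resulting rate `B √|Ω|` carries no logarithm. Since `log 2 > 1/4`, both terms of the minimum are
at least half of it, so no covering argument is needed and `C = 4` works; `K` only enlarges the
right-hand side.

Suprema are taken over finite families only, which keeps them measurable; a dense sequence and
continuity reach the whole ball. Deviations are multiplied by `m` until the end. -/

open MeasureTheory ProbabilityTheory

/-! ### Rademacher sums: contraction and linear classes. -/

/-- The sign `±1` encoded by a Boolean. -/
def boolSign (b : Bool) : ℝ := if b then 1 else -1

@[simp] lemma boolSign_true : boolSign true = 1 := rfl

@[simp] lemma boolSign_false : boolSign false = -1 := rfl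

lemma boolSign_not (b : Bool) : boolSign (!b) = -boolSign b := by
  cases b <;> simp

lemma sum_bool_cons {M : Type*} [AddCommMonoid M] {n : ℕ} (f : (Fin (n + 1) → Bool) → M) :
    ∑ σ, f σ = ∑ τ : Fin n → Bool, (f (Fin.cons true τ) + f (Fin.cons false τ)) := by
  rw [← (Fin.consEquiv fun _ => Bool).sum_comp, Fintype.sum_prod_type, Fintype.sum_bool,
    ← Finset.sum_add_distrib]
  rfl

/-- Contraction for a single sign. The two suprema range over pairs `(i, k)`; exchanging `i` and `k`
changes the sign of `t i - t k`, so the absolute value costs nothing. -/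
lemma ciSup_add_ciSup_sub_le {ι : Type*} [Finite ι] [Nonempty ι] (v s t : ι → ℝ)
    (h : ∀ i k, s i - s k ≤ |t i - t k|) :
    (⨆ i, (v i + s i)) + (⨆ i, (v i - s i)) ≤ (⨆ i, (v i + t i)) + ⨆ i, (v i - t i) := by
  have hb (f : ι → ℝ) : BddAbove (Set.range f) := (Set.finite_range f).bddAbove
  have key (i k) : (v i + s i) + (v k - s k) ≤ (⨆ i, (v i + t i)) + ⨆ i, (v i - t i) := by
    have h1 (i) := le_ciSup (hb fun i => v i + t i) i
    have h2 (i) := le_ciSup (hb fun i => v i - t i) i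
    have h3 := h i k
    have := h1 i; have := h1 k; have := h2 i; have := h2 k
    rcases abs_cases (t i - t k) with ⟨h4, -⟩ | ⟨h4, -⟩ <;> linarith
  rw [← le_sub_iff_add_le]
  refine ciSup_le fun i => ?_
  rw [le_sub_iff_add_le, ← le_sub_iff_add_le']
  exact ciSup_le fun k => by linarith [key i k]

/-- The contraction principle for Rademacher averages over a finite class. -/
theorem sum_sign_iSup_contraction {ι : Type*} [Finite ι] [Nonempty ι] (n : ℕ) (u : ι → ℝ)
    (s t : ι → Fin n → ℝ) (h : ∀ i k j, s i j - s k j ≤ |t i j - t k j|) :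
    ∑ σ : Fin n → Bool, ⨆ i, (u i + ∑ j, boolSign (σ j) * s i j)
      ≤ ∑ σ : Fin n → Bool, ⨆ i, (u i + ∑ j, boolSign (σ j) * t i j) := by
  -- The offset `u` absorbs the first signed term, so the induction hypothesis treats the other
  -- coordinates and the one-sign lemma then replaces `s i 0` by `t i 0`.
  induction n generalizing u with
  | zero => simp
  | succ n ih =>
    simp only [sum_bool_cons, Fin.sum_univ_succ, Fin.cons_zero, Fin.cons_succ, boolSign_true,
      boolSign_false, Finset.sum_add_distrib, one_mul, neg_one_mul, ← add_assoc]
    refine (add_le_add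
      (ih (fun i => u i + s i 0) (fun i j => s i j.succ) (fun i j => t i j.succ)
        fun i k j => h i k _)
      (ih (fun i => u i + -s i 0) (fun i j => s i j.succ) (fun i j => t i j.succ)
        fun i k j => h i k _)).trans ?_
    rw [← Finset.sum_add_distrib, ← Finset.sum_add_distrib]
    refine Finset.sum_le_sum fun τ _ => ?_
    have := ciSup_add_ciSup_sub_le (fun i => u i + ∑ j : Fin n, boolSign (τ j) * t i j.succ)
      (fun i => s i 0) (fun i => t i 0) fun i k => h i k 0
    simpa only [add_right_comm, sub_eq_add_neg] using this

/-- Signed sums of vectors satisfy the parallelogram law. -/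
theorem sum_sign_norm_sq {E : Type*} [NormedAddCommGroup E] [InnerProductSpace ℝ E] (n : ℕ)
    (u : E) (v : Fin n → E) :
    ∑ σ : Fin n → Bool, ‖u + ∑ j, boolSign (σ j) • v j‖ ^ 2
      = 2 ^ n * (‖u‖ ^ 2 + ∑ j, ‖v j‖ ^ 2) := by
  induction n generalizing u with
  | zero => simp
  | succ n ih =>
    simp only [sum_bool_cons, Fin.sum_univ_succ, Fin.cons_zero, Fin.cons_succ, boolSign_true,
      boolSign_false, Finset.sum_add_distrib, one_smul, neg_one_smul, ← add_assoc]
    rw [ih (u + v 0), ih (u + -v 0), ← sub_eq_add_neg]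
    have := parallelogram_law_with_norm ℝ u (v 0)
    rw [pow_succ]
    linear_combination (2 : ℝ) ^ n * this

/-- The Rademacher average of a norm-bounded class of linear functionals. -/
theorem sum_sign_iSup_inner_le {E : Type*} [NormedAddCommGroup E] [InnerProductSpace ℝ E]
    {ι : Type*} [Nonempty ι] {n : ℕ} {B D : ℝ} (hB : 0 ≤ B) (w : ι → E)
    (hw : ∀ i, ‖w i‖ ≤ B) (v : Fin n → E) (hv : ∀ j, ‖v j‖ ^ 2 ≤ D) :
    ∑ σ : Fin n → Bool, ⨆ i, ∑ j, boolSign (σ j) * inner ℝ (w i) (v j)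
      ≤ 2 ^ n * (B * √(n * D)) := by
  have h1 : ∑ σ : Fin n → Bool, ‖∑ j, boolSign (σ j) • v j‖ ^ 2 ≤ 2 ^ n * (n * D) := by
    have := sum_sign_norm_sq n 0 v
    simp only [zero_add, norm_zero, ne_eq, OfNat.ofNat_ne_zero, not_false_eq_true,
      zero_pow] at this
    rw [this]
    gcongr
    simpa using Finset.sum_le_sum fun j (_ : j ∈ Finset.univ) => hv j
  have h2 : ∑ σ : Fin n → Bool, ‖∑ j, boolSign (σ j) • v j‖ ≤ 2 ^ n * √(n * D) := by
    -- Cauchy–Schwarz over the `2 ^ n` sign vectors.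
    refine (abs_le_of_sq_le_sq' (b := 2 ^ n * √(n * D)) ?_ (by positivity)).2
    refine sq_sum_le_card_mul_sum_sq.trans ?_
    -- The bound `0 ≤ D` follows from `hv` only if some index exists.
    rcases Nat.eq_zero_or_pos n with rfl | hn
    · simp
    have hD : 0 ≤ D := (sq_nonneg _).trans (hv ⟨0, hn⟩)
    rw [mul_pow, Real.sq_sqrt (by positivity)]
    simp only [Finset.card_univ, Fintype.card_pi, Fintype.card_bool, Finset.prod_const,
      Fintype.card_fin, Nat.cast_pow, Nat.cast_ofNat]
    calc _ ≤ (2 : ℝ) ^ n * (2 ^ n * (n * D)) := by gcongr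
      _ = _ := by ring
  calc _ ≤ ∑ σ : Fin n → Bool, B * ‖∑ j, boolSign (σ j) • v j‖ := by
        refine Finset.sum_le_sum fun σ _ => ciSup_le fun i => ?_
        simp_rw [← real_inner_smul_right, ← inner_sum]
        exact (real_inner_le_norm _ _).trans (by gcongr; exact hw i)
    _ ≤ _ := by
        rw [← Finset.mul_sum, mul_left_comm]
        gcongr

/-! ### McDiarmid's inequality. -/

lemma measurePreserving_finCons {Z : Type*} [MeasurableSpace Z] (P : Measure Z)
    [IsProbabilityMeasure P] (n : ℕ) :
    MeasurePreserving (fun p : Z × (Fin n → Z) => (Fin.cons p.1 p.2 : Fin (n + 1) → Z))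
      (P.prod (Measure.pi fun _ => P)) (Measure.pi fun _ => P) := by
  convert! (measurePreserving_piFinSuccAbove (fun _ : Fin (n + 1) => P) 0).symm using 1
  ext p : 1
  exact (Fin.insertNth_zero' p.1 p.2).symm

/-- The exponential moment bound behind McDiarmid's bounded difference inequality. -/
theorem integral_exp_le_of_boundedDiff {Z : Type*} [MeasurableSpace Z] (P : Measure Z)
    [IsProbabilityMeasure P] {κ M : ℝ} (t : ℝ) (n : ℕ) (g : (Fin n → Z) → ℝ)
    (hg : Measurable g) (hM : ∀ z, |g z| ≤ M)
    (hd : ∀ z i w, g (Function.update z i w) ≤ g z + κ) :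
    ∫ z, Real.exp (t * (g z - ∫ z', g z' ∂Measure.pi fun _ => P)) ∂(Measure.pi fun _ => P)
      ≤ Real.exp (n * (κ / 2) ^ 2 * t ^ 2 / 2) := by
  induction n with
  | zero =>
    have h (z : Fin 0 → Z) : g z = g default := congrArg g (Subsingleton.elim _ _)
    simp [h]
  | succ n ih =>
    set Q : Measure (Fin n → Z) := Measure.pi fun _ => P with hQ
    have hcons := measurePreserving_finCons P n
    have hgc : Measurable fun p : Z × (Fin n → Z) => g (Fin.cons p.1 p.2) :=
      hg.comp hcons.measurable
    have hgz (z : Z) : Measurable fun s : Fin n → Z => g (Fin.cons z s) :=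
      hgc.comp measurable_prodMk_left
    -- `G` is the conditional expectation of `g` given the first coordinate. Its values lie in an
    -- interval of length `κ`, so Hoeffding's lemma applies to it; the induction hypothesis handles
    -- `g - G` on each slice.
    set G : Z → ℝ := fun z => ∫ s, g (Fin.cons z s) ∂Q with hG
    have hGm : Measurable G := hgc.stronglyMeasurable.integral_prod_right.measurable
    have hint (z : Z) : Integrable (fun s => g (Fin.cons z s)) Q :=
      Integrable.of_bound (hgz z).aestronglyMeasurable M (ae_of_all _ fun s => hM _)
    have hGM (z : Z) : |G z| ≤ M := by
      have := norm_integral_le_of_norm_le_const (μ := Q) (f := fun s => g (Fin.cons z s)) (C := M)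
        (ae_of_all _ fun s => hM _)
      simpa using this
    have hGκ (z w : Z) : G z ≤ G w + κ := by
      have h1 : ∫ s, (g (Fin.cons w s) + κ) ∂Q = G w + κ := by
        rw [integral_add (hint w) (integrable_const _)]; simp [hG]
      rw [← h1]
      refine integral_mono (hint z) ((hint w).add (integrable_const _)) fun s => ?_
      have := hd (Fin.cons w s) 0 z
      simpa using this
    have : Nonempty Z := P.nonempty_of_neZero
    have hbdd : BddBelow (Set.range G) := ⟨-M, by rintro _ ⟨z, rfl⟩; exact (abs_le.1 (hGM z)).1⟩
    have hIcc (z : Z) : G z ∈ Set.Icc (⨅ z, G z) ((⨅ z, G z) + κ) := by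
      refine ⟨ciInf_le hbdd z, ?_⟩
      rw [← sub_le_iff_le_add]
      exact le_ciInf fun w => by linarith [hGκ z w]
    have hhoeff := (hasSubgaussianMGF_of_mem_Icc hGm.aemeasurable
      (ae_of_all P hIcc)).mgf_le t
    have hEg : ∫ z, g z ∂(Measure.pi fun _ => P) = ∫ z, G z ∂P := by
      rw [← hcons.map_eq, integral_map hcons.aemeasurable hg.aestronglyMeasurable,
        integral_prod _ (Integrable.of_bound hgc.aestronglyMeasurable M
          (ae_of_all _ fun s => hM _))]
    have hexpb {a b : ℝ} (ha : |a| ≤ M) (hb : |b| ≤ M) :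
        ‖Real.exp (t * (a - b))‖ ≤ Real.exp (|t| * (M + M)) := by
      rw [Real.norm_eq_abs, Real.abs_exp, Real.exp_le_exp]
      calc t * (a - b) ≤ |t| * |a - b| := by rw [← abs_mul]; exact le_abs_self _
        _ ≤ _ := by gcongr; exact (abs_sub a b).trans (add_le_add ha hb)
    set e := ∫ z, G z ∂P with he
    have heM : |e| ≤ M := by
      have := norm_integral_le_of_norm_le_const (μ := P) (f := G) (C := M) (ae_of_all _ hGM)
      simpa using this
    rw [hEg, ← hcons.map_eq, integral_map hcons.aemeasurable (by fun_prop),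
      integral_prod _ (Integrable.of_bound
        ((hgc.sub_const e).const_mul t).exp.aestronglyMeasurable _
        (ae_of_all _ fun s => hexpb (hM _) heM))]
    have hstep (z : Z) : ∫ s, Real.exp (t * (g (Fin.cons z s) - e)) ∂Q
        ≤ Real.exp (t * (G z - e)) * Real.exp (n * (κ / 2) ^ 2 * t ^ 2 / 2) := by
      have h1 (s : Fin n → Z) : Real.exp (t * (g (Fin.cons z s) - e))
          = Real.exp (t * (G z - e)) * Real.exp (t * (g (Fin.cons z s) - G z)) := by
        rw [← Real.exp_add]; ring_nf
      simp_rw [h1]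
      rw [integral_const_mul]
      gcongr
      refine ih _ (hgz z) (fun s => hM _) fun s i w => ?_
      rw [Fin.cons_update]
      exact hd _ _ _
    have hint2 : Integrable (fun z => Real.exp (t * (G z - e))) P :=
      Integrable.of_bound (by fun_prop) _ (ae_of_all _ fun s => hexpb (hGM _) heM)
    refine (integral_mono_of_nonneg (ae_of_all _ fun z => integral_nonneg fun s => by positivity)
      (hint2.mul_const _) (ae_of_all _ hstep)).trans ?_
    rw [integral_mul_const]
    calc _ ≤ Real.exp ((κ / 2) ^ 2 * t ^ 2 / 2) * Real.exp (n * (κ / 2) ^ 2 * t ^ 2 / 2) := by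
          gcongr
          simpa [mgf, div_pow] using hhoeff
      _ = _ := by
          rw [← Real.exp_add]; push_cast; ring_nf

/-- McDiarmid's bounded difference inequality, for equal difference bounds. -/
theorem measureReal_ge_le_of_boundedDiff {Z : Type*} [MeasurableSpace Z] (P : Measure Z)
    [IsProbabilityMeasure P] {κ M : ℝ} (n : ℕ) (g : (Fin n → Z) → ℝ)
    (hg : Measurable g) (hM : ∀ z, |g z| ≤ M)
    (hd : ∀ z i w, g (Function.update z i w) ≤ g z + κ) {ε : ℝ} (hε : 0 ≤ ε) :
    (Measure.pi fun _ => P).real {z | ε ≤ g z - ∫ z', g z' ∂Measure.pi fun _ => P}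
      ≤ Real.exp (-ε ^ 2 / (2 * (n * (κ / 2) ^ 2))) := by
  have hsub : HasSubgaussianMGF (fun z => g z - ∫ z', g z' ∂Measure.pi fun _ => P)
      ⟨n * (κ / 2) ^ 2, by positivity⟩ (Measure.pi fun _ => P) := by
    refine ⟨fun t => ?_, fun t => integral_exp_le_of_boundedDiff P t n g hg hM hd⟩
    refine integrable_exp_mul_of_mem_Icc (a := -M - ∫ z', g z' ∂Measure.pi fun _ => P)
      (b := M - ∫ z', g z' ∂Measure.pi fun _ => P) (by fun_prop) (ae_of_all _ fun z => ?_)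
    have := abs_le.1 (hM z)
    constructor <;> linarith
  exact hsub.measure_ge_le hε

/-! ### Symmetrization and uniform deviation bounds. -/

lemma abs_ciSup_le_of_forall {ι : Type*} [Finite ι] [Nonempty ι] {f : ι → ℝ} {M : ℝ}
    (h : ∀ i, |f i| ≤ M) : |⨆ i, f i| ≤ M := by
  obtain ⟨i, hi⟩ := exists_eq_ciSup_of_finite (f := f)
  exact hi ▸ h i

lemma abs_deviation_le {Z : Type*} [MeasurableSpace Z] (P : Measure Z) [IsProbabilityMeasure P]
    {c : ℝ} {F : Z → ℝ} (hF : Measurable F) (hFc : ∀ z, F z ∈ Set.Icc 0 c) {m : ℕ}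
    (S : Fin m → Z) : |(m : ℝ) * ∫ z, F z ∂P - ∑ j, F (S j)| ≤ m * c := by
  have h2 : 0 ≤ ∫ z, F z ∂P := integral_nonneg fun z => (hFc z).1
  have h3 : ∫ z, F z ∂P ≤ c := by
    simpa using integral_mono (Integrable.of_mem_Icc 0 c hF.aemeasurable
      (ae_of_all _ hFc)) (integrable_const (μ := P) c) fun z => (hFc z).2
  have h4 : 0 ≤ ∑ j, F (S j) := Finset.sum_nonneg fun j _ => (hFc _).1
  have h5 : ∑ j, F (S j) ≤ m * c := by
    simpa using Finset.sum_le_sum fun j (_ : j ∈ Finset.univ) => (hFc (S j)).2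
  have h6 : (m : ℝ) * ∫ z, F z ∂P ≤ m * c := by gcongr
  have h7 : 0 ≤ (m : ℝ) * ∫ z, F z ∂P := by positivity
  rw [abs_le]
  constructor <;> linarith

/-- The symmetrization inequality for the uniform deviation over a finite class. -/
theorem integral_iSup_deviation_le {Z : Type*} [MeasurableSpace Z] (P : Measure Z)
    [IsProbabilityMeasure P] {ι : Type*} [Finite ι] [Nonempty ι] {m : ℕ} {c ρ : ℝ}
    (F : ι → Z → ℝ) (hF : ∀ i, Measurable (F i)) (hFc : ∀ i z, F i z ∈ Set.Icc 0 c)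
    (hρ : ∀ S : Fin m → Z,
      ∑ σ : Fin m → Bool, ⨆ i, ∑ j, boolSign (σ j) * F i (S j) ≤ 2 ^ m * ρ) :
    ∫ S : Fin m → Z, (⨆ i, ((m : ℝ) * ∫ z, F i z ∂P - ∑ j, F i (S j)))
      ∂(Measure.pi fun _ => P) ≤ 2 * ρ := by
  set Q : Measure (Fin m → Z) := Measure.pi fun _ => P with hQ
  set W : Measure (Fin m → Z × Z) := Measure.pi fun _ => P.prod P with hW
  have hb (f : ι → ℝ) : BddAbove (Set.range f) := (Set.finite_range f).bddAbove
  have hFi (i : ι) : Integrable (F i) P := Integrable.of_mem_Icc 0 c (hF i).aemeasurable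
    (ae_of_all _ (hFc i))
  have hFe (i : ι) (j : Fin m) : Integrable (fun S : Fin m → Z => F i (S j)) Q :=
    Integrable.of_mem_Icc 0 c ((hF i).comp (measurable_pi_apply j)).aemeasurable
      (ae_of_all _ fun S => hFc i _)
  have hFs (i : ι) (j : Fin m) (z : Z) : Integrable (fun S : Fin m → Z => F i (S j) - F i z) Q :=
    (hFe i j).sub (integrable_const _)
  have hFeI (i : ι) (j : Fin m) : ∫ S : Fin m → Z, F i (S j) ∂Q = ∫ z, F i z ∂P := by
    have h := measurePreserving_eval (fun _ : Fin m => P) j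
    rw [← h.map_eq, integral_map h.aemeasurable (hF i).aestronglyMeasurable]
  have hdiff (i : ι) (z z' : Z) : |F i z' - F i z| ≤ c := by
    rw [abs_le]
    have h1 := hFc i z; have h2 := hFc i z'
    constructor <;> linarith [h1.1, h1.2, h2.1, h2.2]
  set Ψ : (Fin m → Bool) → (Fin m → Z × Z) → ℝ := fun σ w =>
    ⨆ i, ∑ j, boolSign (σ j) * (F i (w j).2 - F i (w j).1) with hΨ
  have hΨm (σ) : Measurable (Ψ σ) := by
    refine Measurable.iSup fun i => Finset.measurable_sum _ fun j _ => ?_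
    exact (((hF i).comp (measurable_snd.comp (measurable_pi_apply j))).sub
      ((hF i).comp (measurable_fst.comp (measurable_pi_apply j)))).const_mul _
  have hΨb (σ w) : |Ψ σ w| ≤ m * c := by
    refine abs_ciSup_le_of_forall fun i => (Finset.abs_sum_le_sum_abs _ _).trans ?_
    have : ∀ j ∈ Finset.univ, |boolSign (σ j) * (F i (w j).2 - F i (w j).1)| ≤ c := by
      intro j _
      rw [abs_mul]
      cases σ j <;> simpa using hdiff i _ _
    simpa using Finset.sum_le_sum this
  have hΨi (σ) : Integrable (Ψ σ) W :=
    Integrable.of_bound (hΨm σ).aestronglyMeasurable _ (ae_of_all _ (hΨb σ))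
  -- ghost sample
  let e := MeasurableEquiv.arrowProdEquivProdArrow Z Z (Fin m)
  have he : MeasurePreserving e W (Q.prod Q) :=
    measurePreserving_arrowProdEquivProdArrow Z Z (Fin m) (fun _ => P) (fun _ => P)
  have hgi : Integrable (fun p => Ψ (fun _ => true) (e.symm p)) (Q.prod Q) :=
    Integrable.of_bound ((hΨm _).comp e.symm.measurable).aestronglyMeasurable _
      (ae_of_all _ fun p => hΨb _ _)
  have hghost : ∫ S, (⨆ i, ((m : ℝ) * ∫ z, F i z ∂P - ∑ j, F i (S j))) ∂Q
      ≤ ∫ w, Ψ (fun _ => true) w ∂W := by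
    have h1 : ∫ w, Ψ (fun _ => true) w ∂W
        = ∫ S, ∫ S', Ψ (fun _ => true) (e.symm (S, S')) ∂Q ∂Q := by
      rw [← integral_prod _ hgi, ← he.integral_comp']
      simp
    rw [h1]
    refine integral_mono (Integrable.of_bound (C := m * c) (Measurable.aestronglyMeasurable <|
      Measurable.iSup fun i => measurable_const.sub <| Finset.measurable_sum _ fun j _ =>
        (hF i).comp (measurable_pi_apply j)) (ae_of_all _ fun S => ?_)) hgi.integral_prod_left
      fun S => ?_
    · exact abs_ciSup_le_of_forall fun i => abs_deviation_le P (hF i) (hFc i) S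
    -- The deviation is the ghost-sample mean of a difference, and a supremum of means is at most
    -- the mean of the supremum.
    · refine ciSup_le fun i => ?_
      have h2 : ∫ S' : Fin m → Z, ∑ j, (F i (S' j) - F i (S j)) ∂Q
          = (m : ℝ) * ∫ z, F i z ∂P - ∑ j, F i (S j) := by
        rw [integral_finsetSum _ fun j _ => hFs i j (S j)]
        simp_rw [integral_sub (hFe i _) (integrable_const _), hFeI]
        simp
      rw [← h2]
      refine integral_mono (integrable_finsetSum _ fun j _ => hFs i j (S j))
        (Integrable.of_bound ((hΨm _).comp
          (e.symm.measurable.comp measurable_prodMk_left)).aestronglyMeasurable _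
          (ae_of_all _ fun p => hΨb _ _)) fun S' => ?_
      have := le_ciSup (hb fun i => ∑ j, boolSign true * (F i (S' j) - F i (S j))) i
      exact le_trans (le_of_eq (by simp)) this
  -- exchanging the two samples at the coordinates with negative sign
  have hswap (σ : Fin m → Bool) : ∫ w, Ψ σ w ∂W = ∫ w, Ψ (fun _ => true) w ∂W := by
    have hs : MeasurePreserving (fun (w : Fin m → Z × Z) j => (if σ j then id else Prod.swap) (w j))
        W W := by
      refine measurePreserving_pi _ _ fun j => ?_
      cases σ j
      · exact Measure.measurePreserving_swap
      · exact MeasurePreserving.id _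
    rw [← hs.map_eq, integral_map hs.aemeasurable (hΨm _).aestronglyMeasurable, hs.map_eq]
    refine integral_congr_ae (ae_of_all _ fun w => ?_)
    refine iSup_congr fun i => Finset.sum_congr rfl fun j _ => ?_
    cases h : σ j <;> simp [h]
  -- The supremum of a difference splits into one supremum per sample. Negating all signs permutes
  -- the sign vectors, so each half contributes `ρ`.
  have hpoint (w : Fin m → Z × Z) : ∑ σ, Ψ σ w ≤ 2 ^ m * (2 * ρ) := by
    have hneg : ∑ σ : Fin m → Bool, ⨆ i, ∑ j, boolSign (!(σ j)) * F i (w j).1 ≤ 2 ^ m * ρ := by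
      refine le_trans (le_of_eq ?_) (hρ fun j => (w j).1)
      exact (Equiv.piCongrRight fun _ : Fin m => Equiv.boolNot).sum_comp
        fun σ : Fin m → Bool => ⨆ i, ∑ j, boolSign (σ j) * F i (w j).1
    calc ∑ σ, Ψ σ w ≤ ∑ σ : Fin m → Bool, ((⨆ i, ∑ j, boolSign (σ j) * F i (w j).2)
          + ⨆ i, ∑ j, boolSign (!(σ j)) * F i (w j).1) := by
          refine Finset.sum_le_sum fun σ _ => ciSup_le fun i => ?_
          refine le_trans (le_of_eq ?_) (add_le_add
            (le_ciSup (hb fun i => ∑ j, boolSign (σ j) * F i (w j).2) i)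
            (le_ciSup (hb fun i => ∑ j, boolSign (!(σ j)) * F i (w j).1) i))
          rw [← Finset.sum_add_distrib]
          refine Finset.sum_congr rfl fun j _ => ?_
          rw [boolSign_not]; ring
      _ ≤ _ := by
          rw [Finset.sum_add_distrib]
          linarith [hρ fun j => (w j).2]
  refine hghost.trans ?_
  have h1 : (2 : ℝ) ^ m * ∫ w, Ψ (fun _ => true) w ∂W = ∫ w, ∑ σ, Ψ σ w ∂W := by
    rw [integral_finsetSum _ fun σ _ => hΨi σ]
    simp [hswap]
  have h2 : ∫ w, ∑ σ, Ψ σ w ∂W ≤ 2 ^ m * (2 * ρ) := by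
    simpa using integral_mono (integrable_finsetSum _ fun σ _ => hΨi σ)
      (integrable_const (μ := W) _) hpoint
  exact le_of_mul_le_mul_left (h1.trans_le h2) (by positivity)

/-- The Rademacher generalization bound for a finite class. -/
theorem uniform_deviation_of_finite {Z : Type*} [MeasurableSpace Z] (P : Measure Z)
    [IsProbabilityMeasure P] {ι : Type*} [Finite ι] [Nonempty ι] {m : ℕ} (hm : 1 ≤ m) {c ρ : ℝ}
    (hc : 0 < c) (F : ι → Z → ℝ) (hF : ∀ i, Measurable (F i))
    (hFc : ∀ i z, F i z ∈ Set.Icc 0 c)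
    (hρ : ∀ S : Fin m → Z,
      ∑ σ : Fin m → Bool, ⨆ i, ∑ j, boolSign (σ j) * F i (S j) ≤ 2 ^ m * ρ)
    {δ : ℝ} (hδ : δ ∈ Set.Ioo (0 : ℝ) 1) :
    ENNReal.ofReal (1 - δ) ≤ (Measure.pi fun _ : Fin m => P)
      {S | ∀ i, (m : ℝ) * ∫ z, F i z ∂P - ∑ j, F i (S j)
        ≤ 2 * ρ + c * √(m * Real.log (1 / δ))} := by
  have hb (f : ι → ℝ) : BddAbove (Set.range f) := (Set.finite_range f).bddAbove
  set Q : Measure (Fin m → Z) := Measure.pi fun _ => P with hQ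
  set g : (Fin m → Z) → ℝ := fun S => ⨆ i, ((m : ℝ) * ∫ z, F i z ∂P - ∑ j, F i (S j)) with hg
  have hgm : Measurable g := Measurable.iSup fun i => measurable_const.sub <|
    Finset.measurable_sum _ fun j _ => (hF i).comp (measurable_pi_apply j)
  have hgM (S) : |g S| ≤ m * c :=
    abs_ciSup_le_of_forall fun i => abs_deviation_le P (hF i) (hFc i) S
  have hgd (S : Fin m → Z) (k : Fin m) (w : Z) : g (Function.update S k w) ≤ g S + c := by
    refine ciSup_le fun i => ?_
    have h1 := le_ciSup (hb fun i => (m : ℝ) * ∫ z, F i z ∂P - ∑ j, F i (S j)) i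
    have h2 : ∑ j, (F i (S j) - F i (Function.update S k w j))
        ≤ ∑ j, if j = k then c else 0 := by
      refine Finset.sum_le_sum fun j _ => ?_
      split_ifs with h
      · linarith [(hFc i (S j)).2, (hFc i (Function.update S k w j)).1]
      · simp [Function.update_of_ne h]
    rw [Finset.sum_sub_distrib, Finset.sum_ite_eq' Finset.univ k] at h2
    simp only [Finset.mem_univ, if_true] at h2
    linarith
  have hlog : 0 < Real.log (1 / δ) := Real.log_pos (by rw [one_lt_div hδ.1]; exact hδ.2)
  have hm0 : (0 : ℝ) < m := by exact_mod_cast hm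
  have htail := measureReal_ge_le_of_boundedDiff P m g hgm hgM hgd
    (ε := c * √(m * Real.log (1 / δ))) (by positivity)
  -- The exponent equals `-2 log (1/δ)`, so the tail is in fact at most `δ ^ 2`.
  have hexp : Real.exp (-(c * √(m * Real.log (1 / δ))) ^ 2 / (2 * (m * (c / 2) ^ 2))) ≤ δ := by
    have h1 : -(c * √(m * Real.log (1 / δ))) ^ 2 / (2 * (m * (c / 2) ^ 2))
        = -2 * Real.log (1 / δ) := by
      rw [mul_pow, Real.sq_sqrt (by positivity)]
      field
    rw [h1]
    calc _ ≤ Real.exp (-Real.log (1 / δ)) := by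
          rw [Real.exp_le_exp]; linarith
      _ = δ := by rw [one_div, Real.log_inv, neg_neg, Real.exp_log hδ.1]
  set T : Set (Fin m → Z) :=
    {S | c * √(m * Real.log (1 / δ)) ≤ g S - ∫ S', g S' ∂Q} with hT
  have hTm : MeasurableSet T := measurableSet_le measurable_const (hgm.sub_const _)
  have hTc : ENNReal.ofReal (1 - δ) ≤ Q Tᶜ := by
    rw [← ofReal_measureReal, probReal_compl_eq_one_sub hTm]
    exact ENNReal.ofReal_le_ofReal (by linarith)
  refine hTc.trans (measure_mono fun S hS i => ?_)
  have h1 := le_ciSup (hb fun i => (m : ℝ) * ∫ z, F i z ∂P - ∑ j, F i (S j)) i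
  have h2 := integral_iSup_deviation_le P F hF hFc hρ
  have h3 : g S - ∫ S', g S' ∂Q < c * √(m * Real.log (1 / δ)) := not_le.1 hS
  have h4 : ∫ S', g S' ∂Q ≤ 2 * ρ := h2
  have h5 : (m : ℝ) * ∫ z, F i z ∂P - ∑ j, F i (S j) ≤ g S := h1
  linarith

/-- The Rademacher generalization bound for a countable class. -/
theorem uniform_deviation_of_seq {Z : Type*} [MeasurableSpace Z] (P : Measure Z)
    [IsProbabilityMeasure P] {m : ℕ} (hm : 1 ≤ m) {c ρ : ℝ}
    (hc : 0 < c) (F : ℕ → Z → ℝ) (hF : ∀ i, Measurable (F i))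
    (hFc : ∀ i z, F i z ∈ Set.Icc 0 c)
    (hρ : ∀ (n : ℕ) (S : Fin m → Z),
      ∑ σ : Fin m → Bool, ⨆ i : Fin (n + 1), ∑ j, boolSign (σ j) * F i (S j) ≤ 2 ^ m * ρ)
    {δ : ℝ} (hδ : δ ∈ Set.Ioo (0 : ℝ) 1) :
    ENNReal.ofReal (1 - δ) ≤ (Measure.pi fun _ : Fin m => P)
      {S | ∀ i, (m : ℝ) * ∫ z, F i z ∂P - ∑ j, F i (S j)
        ≤ 2 * ρ + c * √(m * Real.log (1 / δ))} := by
  set E : ℕ → Set (Fin m → Z) := fun n => {S | ∀ i : Fin (n + 1),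
    (m : ℝ) * ∫ z, F i z ∂P - ∑ j, F i (S j) ≤ 2 * ρ + c * √(m * Real.log (1 / δ))} with hE
  have hEm (n) : MeasurableSet (E n) := by
    simp only [hE, Set.ofPred_forall]
    exact MeasurableSet.iInter fun i => measurableSet_le (measurable_const.sub <|
      Finset.measurable_sum _ fun j _ => (hF i).comp (measurable_pi_apply j)) measurable_const
  have hanti : Antitone E := fun a b hab S hS i => hS ⟨i, by omega⟩
  have hsub : (⋂ n, E n) ⊆ {S | ∀ i, (m : ℝ) * ∫ z, F i z ∂P - ∑ j, F i (S j)
      ≤ 2 * ρ + c * √(m * Real.log (1 / δ))} := fun S hS i =>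
    Set.mem_iInter.1 hS i ⟨i, i.lt_succ_self⟩
  refine le_trans ?_ (measure_mono hsub)
  -- Continuity from above: the finite-class bound does not depend on `n`.
  rw [hanti.measure_iInter (fun n => (hEm n).nullMeasurableSet) ⟨0, measure_ne_top _ _⟩]
  exact le_iInf fun n => uniform_deviation_of_finite P hm hc (fun i : Fin (n + 1) => F i)
    (fun i => hF i) (fun i => hFc i) (hρ n) hδ

/-- The generalization bound for a norm-bounded class of linear predictors over a bounded feature
map, with a bounded Lipschitz loss. -/
theorem uniform_deviation_of_linear {X E : Type*} [MeasurableSpace X] [NormedAddCommGroup E]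
    [InnerProductSpace ℝ E] [SecondCountableTopology E] [MeasurableSpace E] [BorelSpace E]
    {φ : X → E} (hφ : Measurable φ) {D : ℝ} (hD : ∀ x, ‖φ x‖ ^ 2 ≤ D)
    {m : ℕ} (hm : 1 ≤ m) {B c : ℝ} (hB : 0 < B) (hc : 0 < c) {L : NNReal} {ℓ : ℝ → ℝ → ℝ}
    (hℓ : Measurable (Function.uncurry ℓ)) (hℓc : ∀ y z, ℓ y z ∈ Set.Icc 0 c)
    (hL : ∀ y, LipschitzWith L (ℓ y)) {δ : ℝ} (hδ : δ ∈ Set.Ioo (0 : ℝ) 1)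
    (P : Measure (X × ℝ)) [IsProbabilityMeasure P] :
    ENNReal.ofReal (1 - δ) ≤ (Measure.pi fun _ : Fin m => P)
      {S | ∀ w : E, ‖w‖ ≤ B → (m : ℝ) * ∫ p, ℓ p.2 (inner ℝ w (φ p.1)) ∂P
          - ∑ j, ℓ (S j).2 (inner ℝ w (φ (S j).1))
        ≤ 2 * (L * B * √(m * D)) + c * √(m * Real.log (1 / δ))} := by
  have : Nonempty (Metric.closedBall (0 : E) B) := ⟨⟨0, by simp [hB.le]⟩⟩
  set u : ℕ → Metric.closedBall (0 : E) B := TopologicalSpace.denseSeq _ with hu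
  have hmeas (w : E) : Measurable fun p : X × ℝ => ℓ p.2 (inner ℝ w (φ p.1)) :=
    hℓ.comp (measurable_snd.prodMk
      (measurable_const.inner (hφ.comp measurable_fst)))
  have hrad (n : ℕ) (S : Fin m → X × ℝ) : ∑ σ : Fin m → Bool, ⨆ i : Fin (n + 1),
      ∑ j, boolSign (σ j) * ℓ (S j).2 (inner ℝ (u i : E) (φ (S j).1))
      ≤ 2 ^ m * (L * B * √(m * D)) := by
    have h1 := sum_sign_iSup_contraction m (fun _ : Fin (n + 1) => 0)
      (fun i j => ℓ (S j).2 (inner ℝ (u i : E) (φ (S j).1)))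
      -- Moving `L` into the weight makes the contraction 1-Lipschitz and gives weights of norm at
      -- most `L * B`.
      (fun i j => inner ℝ ((L : ℝ) • (u i : E)) (φ (S j).1)) fun i k j => by
        refine (le_abs_self _).trans ?_
        have := (hL (S j).2).dist_le_mul (inner ℝ (u i : E) (φ (S j).1))
          (inner ℝ (u k : E) (φ (S j).1))
        rw [Real.dist_eq, Real.dist_eq] at this
        rwa [real_inner_smul_left, real_inner_smul_left, ← mul_sub, abs_mul, NNReal.abs_eq]
    simp only [zero_add] at h1
    refine h1.trans (sum_sign_iSup_inner_le (by positivity) _ (fun i => ?_) _ fun j => hD _)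
    rw [norm_smul, Real.norm_eq_abs, NNReal.abs_eq]
    gcongr
    exact mem_closedBall_zero_iff.1 (u i).2
  refine (uniform_deviation_of_seq P hm hc _ (fun i => hmeas (u i)) (fun i z => hℓc _ _) hrad
    hδ).trans (measure_mono fun S hS w hw => ?_)
  -- The deviation is continuous in `w`, by dominated convergence with bound `c`, so the inequality
  -- extends from the dense sequence to the ball.
  have hcont : Continuous fun w : Metric.closedBall (0 : E) B =>
      (m : ℝ) * ∫ p, ℓ p.2 (inner ℝ (w : E) (φ p.1)) ∂P
        - ∑ j, ℓ (S j).2 (inner ℝ (w : E) (φ (S j).1)) := by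
    have hpt (p : X × ℝ) : Continuous fun w : Metric.closedBall (0 : E) B =>
        ℓ p.2 (inner ℝ (w : E) (φ p.1)) :=
      (hL p.2).continuous.comp (continuous_subtype_val.inner continuous_const)
    refine (continuous_const.mul ?_).sub (continuous_finsetSum _ fun j _ => hpt _)
    refine continuous_of_dominated (bound := fun _ => c)
      (fun w => (hmeas w).aestronglyMeasurable) (fun w => ae_of_all _ fun p => ?_)
      (integrable_const _) (ae_of_all _ hpt)
    rw [Real.norm_eq_abs, abs_of_nonneg (hℓc _ _).1]
    exact (hℓc _ _).2
  have hclosed := isClosed_le hcont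
    (continuous_const (y := 2 * (L * B * √(m * D)) + c * √(m * Real.log (1 / δ))))
  have hall := (TopologicalSpace.denseRange_denseSeq (Metric.closedBall (0 : E) B)).induction_on
    (p := fun w => (m : ℝ) * ∫ p, ℓ p.2 (inner ℝ (w : E) (φ p.1)) ∂P
        - ∑ j, ℓ (S j).2 (inner ℝ (w : E) (φ (S j).1))
      ≤ 2 * (L * B * √(m * D)) + c * √(m * Real.log (1 / δ)))
    ⟨w, by simpa using hw⟩ hclosed hS
  exact hall

/-! ### Trigonometric polynomials as linear predictors. -/

namespace GTP

/-- The coefficients of a generalized trigonometric polynomial as a Euclidean vector. -/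
def coeffVec {d : ℕ} {Ωpos : Finset (Fin d → ℝ)} (a₀ : ℝ) (a b : Ωpos → ℝ) :
    EuclideanSpace ℝ (Unit ⊕ Ωpos ⊕ Ωpos) :=
  WithLp.toLp 2 (Sum.elim (fun _ => a₀) (Sum.elim a b))

/-- The trigonometric feature map. -/
noncomputable def feature {d : ℕ} (Ωpos : Finset (Fin d → ℝ)) (x : Input d) :
    EuclideanSpace ℝ (Unit ⊕ Ωpos ⊕ Ωpos) :=
  coeffVec (1 / 2) (fun ω => Real.cos (phase ω.1 x)) (fun ω => Real.sin (phase ω.1 x))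

lemma gtp_eq_inner {d : ℕ} {Ωpos : Finset (Fin d → ℝ)} (a₀ : ℝ) (a b : Ωpos → ℝ) (x : Input d) :
    gtp Ωpos a₀ a b x = inner ℝ (coeffVec a₀ a b) (feature Ωpos x) := by
  simp only [gtp, feature, coeffVec, PiLp.inner_apply, Fintype.sum_sum_type, Sum.elim_inl,
    Sum.elim_inr, Finset.univ_unique, Finset.sum_singleton, Finset.sum_add_distrib,
    RCLike.inner_apply, conj_trivial]
  simp only [mul_comm, div_eq_mul_inv, one_mul]

lemma norm_coeffVec {d : ℕ} {Ωpos : Finset (Fin d → ℝ)} (a₀ : ℝ) (a b : Ωpos → ℝ) :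
    ‖coeffVec a₀ a b‖ = coeffNorm a₀ a b := by
  simp [coeffVec, coeffNorm, EuclideanSpace.norm_eq, Finset.sum_add_distrib]

lemma norm_feature_sq {d : ℕ} (Ωpos : Finset (Fin d → ℝ)) (x : Input d) :
    ‖feature Ωpos x‖ ^ 2 = 1 / 4 + Ωpos.card := by
  rw [feature, norm_coeffVec, coeffNorm, Real.sq_sqrt (by positivity)]
  simp only [Real.cos_sq_add_sin_sq]
  norm_num

lemma measurable_feature {d : ℕ} (Ωpos : Finset (Fin d → ℝ)) : Measurable (feature Ωpos) := by
  have hphase (ω : Fin d → ℝ) : Measurable (phase ω) :=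
    Finset.measurable_sum _ fun i _ =>
      (measurable_subtype_coe.comp (measurable_pi_apply i)).const_mul _
  refine (WithLp.measurable_toLp 2 _).comp (measurable_pi_iff.2 ?_)
  rintro (_ | ω | ω)
  · exact measurable_const
  · exact (hphase ω.1).cos
  · exact (hphase ω.1).sin

/-- Weaker than `|Ω| = 2|Ω₊| + 1`, but enough both for the feature norm and for `|Ω| ≥ 2`. -/
lemma IsSplit.card_pos_add_one_le {d : ℕ} {Ω Ωpos Ωneg : Finset (Fin d → ℝ)}
    (h : IsSplit Ω Ωpos Ωneg) : Ωpos.card + 1 ≤ Ω.card := by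
  have h1 : Ωpos ⊆ Ω.erase 0 := h.union_eq ▸ Finset.subset_union_left
  rw [← Finset.card_erase_add_one h.zero_mem]
  exact Nat.add_le_add_right (Finset.card_le_card h1) 1

end GTP

/-! ### Comparison with the stated minimum, and conclusion. -/

lemma mul_sqrt_le_four_mul_min {A N d K : ℝ} (hA : 0 ≤ A) (hN : 2 ≤ N) (hd : 1 ≤ d) :
    2 * (A * √N) ≤ 4 * min (max K (A * √N) * √(Real.log (2 * d))) (A * √(N * Real.log N)) := by
  -- Both logarithms are at least `log 2 > 1/4`; this is where the constant 4 comes from.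
  have key {y : ℝ} (hy : 2 ≤ y) : 1 / 2 ≤ √(Real.log y) := by
    refine Real.le_sqrt_of_sq_le ?_
    have := Real.log_le_log two_pos hy
    linarith [Real.log_two_gt_d9]
  have h0 : 0 ≤ A * √N := by positivity
  rw [mul_min_of_nonneg _ _ (by norm_num : (0 : ℝ) ≤ 4), le_min_iff]
  constructor
  · have h1 : A * √N * (1 / 2) ≤ max K (A * √N) * √(Real.log (2 * d)) :=
      mul_le_mul (le_max_right _ _) (key (by linarith)) (by norm_num) (h0.trans (le_max_right _ _))
    linarith
  · rw [Real.sqrt_mul (by linarith), ← mul_assoc A]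
    have := mul_le_mul_of_nonneg_left (key hN) h0
    linarith

theorem mainTheorem2 :
    ∃ C : ℝ, 0 < C ∧
      ∀ (d m : ℕ), 1 ≤ d → 1 ≤ m →
      ∀ (Ω Ωpos Ωneg : Finset (Fin d → ℝ)), GTP.IsSplit Ω Ωpos Ωneg →
      ∀ (hne : Ωpos.Nonempty) (B : ℝ), 0 < B →
      ∀ (c : ℝ) (L : NNReal) (ℓ : ℝ → ℝ → ℝ),
        Measurable (Function.uncurry ℓ) →
        (∀ y z, ℓ y z ∈ Set.Icc 0 c) →
        (∀ y, LipschitzWith L (ℓ y)) →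
      ∀ (δ : ℝ), δ ∈ Set.Ioo (0 : ℝ) 1 →
      ∀ (P : MeasureTheory.Measure (GTP.Input d × ℝ)) [MeasureTheory.IsProbabilityMeasure P],
        ENNReal.ofReal (1 - δ) ≤
          MeasureTheory.Measure.pi (fun _ : Fin m => P)
            {S | ∀ f ∈ GTP.gtpClass Ωpos B,
              GTP.risk ℓ P f - GTP.empRisk ℓ S f ≤
                C * ((L : ℝ) *
                    min (max (GTP.freqBound Ωpos hne) (B * √(Ω.card : ℝ))
                          * √(Real.log (2 * (d : ℝ))))
                        (B * √((Ω.card : ℝ) * Real.log (Ω.card : ℝ))) / √(m : ℝ)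
                  + c * √(Real.log (1 / δ)) / √(m : ℝ))} := by
  refine ⟨4, by norm_num, ?_⟩
  intro d m hd hm Ω Ωpos Ωneg hsplit hne B hB c L ℓ hℓ hℓc hL δ hδ P _
  have hm0 : (0 : ℝ) < m := by exact_mod_cast hm
  have hcard : (Ωpos.card : ℝ) + 1 ≤ Ω.card := by exact_mod_cast hsplit.card_pos_add_one_le
  have hpos : (1 : ℝ) ≤ Ωpos.card := by exact_mod_cast hne.card_pos
  have hmin := mul_sqrt_le_four_mul_min (K := GTP.freqBound Ωpos hne) (d := (d : ℝ)) hB.le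
    (by linarith : (2 : ℝ) ≤ Ω.card) (by exact_mod_cast hd)
  have hc : 0 ≤ c := (hℓc 0 0).1.trans (hℓc 0 0).2
  -- The concentration bound requires `c > 0`. For `c = 0` the loss vanishes and the event is the
  -- whole space.
  rcases hc.eq_or_lt with rfl | hc
  · have hzero (y z : ℝ) : ℓ y z = 0 := le_antisymm (hℓc y z).2 (hℓc y z).1
    refine le_of_le_of_eq (b := 1) ?_ ?_
    · rw [← ENNReal.ofReal_one]
      exact ENNReal.ofReal_le_ofReal (by linarith [hδ.1])
    · symm
      convert! measure_univ (μ := Measure.pi fun _ : Fin m => P) using 2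
      refine Set.eq_univ_of_forall fun S f _ => ?_
      have h0 : 0 ≤ B * √(Ω.card : ℝ) := by positivity
      simp only [GTP.risk, GTP.empRisk, hzero, integral_zero, Finset.sum_const_zero, mul_zero,
        sub_zero, zero_mul, zero_div, add_zero]
      have := h0.trans ((by linarith : _ ≤ 2 * (B * √(Ω.card : ℝ))).trans hmin)
      have h2 := nonneg_of_mul_nonneg_right this four_pos
      positivity
  refine (uniform_deviation_of_linear (GTP.measurable_feature Ωpos) (D := Ω.card)
    (fun x => by rw [GTP.norm_feature_sq]; linarith) hm hB hc hℓ hℓc hL hδ P).trans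
    (measure_mono fun S hS f hf => ?_)
  obtain ⟨a₀, a, b, hab, rfl⟩ := hf
  have h := hS (GTP.coeffVec a₀ a b) (by rwa [GTP.norm_coeffVec])
  simp only [← GTP.gtp_eq_inner] at h
  simp only [GTP.risk, GTP.empRisk]
  -- Multiplying by `m` matches the unnormalized deviation; `m / √m = √m` then restores the rate.
  rw [← mul_le_mul_iff_right₀ hm0]
  refine le_trans (le_of_eq ?_) (h.trans ?_)
  · field_simp
  have hsm : (m : ℝ) / √(m : ℝ) = √(m : ℝ) := Real.div_sqrt
  have hlog : 0 ≤ √(Real.log (1 / δ)) := Real.sqrt_nonneg _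
  rw [Real.sqrt_mul hm0.le, Real.sqrt_mul hm0.le]
  set μ := min (max (GTP.freqBound Ωpos hne) (B * √(Ω.card : ℝ)) * √(Real.log (2 * (d : ℝ))))
    (B * √((Ω.card : ℝ) * Real.log (Ω.card : ℝ))) with hμ
  calc 2 * (L * B * (√(m : ℝ) * √(Ω.card : ℝ))) + c * (√(m : ℝ) * √(Real.log (1 / δ)))
      = L * √(m : ℝ) * (2 * (B * √(Ω.card : ℝ))) + 1 * (c * √(m : ℝ) * √(Real.log (1 / δ))) := by
        ring
    _ ≤ L * √(m : ℝ) * (4 * μ) + 4 * (c * √(m : ℝ) * √(Real.log (1 / δ))) := by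
        gcongr
        norm_num
    _ = 4 * (L * μ * ((m : ℝ) / √(m : ℝ)) + c * √(Real.log (1 / δ)) * ((m : ℝ) / √(m : ℝ))) := by
        rw [hsm]; ring
    _ = _ := by ring
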